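/- Let $X$ be a set and let $\mathcal R$ be a Riesz subspace and unital subalgebra of the algebra $\mathbb R^X$ of all real-valued functions on $X$ with pointwise operations and pointwise order; that is, $\mathcal R$ is a linear subspace of $\mathbb R^X$ which contains the constant function $1$ and is closed under products and under $f\mapsto |f|$. Write $\mathcal R^+=\{f\in\mathcal R : f\ge 0\}$. Assume that there is an increasing sequence $(\hat v_n)_{n\in\mathbb N}$ in $\mathcal R^+$ such that the set $\mathcal S=\{f\in\mathcal R : |f|\le \hat v_n \text{ for some } n\in\mathbb N\}$ has the following properties: - $\mathcal S$ is a unital subalgebra of $\mathcal R$. - $\mathcal S$ is point-separating: for all $x,y\in X$ with $x\ne y$ there is an $f\in\mathcal S$ with $f(x)\ne f(y)$. - $X$ is complete in the following sense: for every net $(x_i)_{i\in I}$ in $X$ over a non-empty directed partially ordered set $I$ such that $(f(x_i))_{i\in I}$ is a Cauchy net in $\mathbb R$ for every $f\in\mathcal S$, there is an $\hat x\in X$ such that $(f(x_i))_{i\in I}$ converges to $f(\hat x)$ for every $f\in\mathcal S$. Then: 1. Every positive linear functional $\omega\colon\mathcal R\to\mathbb R$ (i.e. $\omega(f)\ge 0$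 for all $f\in\mathcal R^+$) is a Daniell integral: $\inf_{k}\omega(f_k)=0$ for every decreasing sequence $(f_k)_{k\in\mathbb N}$ in $\mathcal R^+$ with $\inf_k f_k(x)=0$ for all $x\in X$. 2. For every Riesz homomorphism $\rho\colon\mathcal R\to\mathbb R$ (i.e. $\rho$ is linear and $\rho(|f|)=|\rho(f)|$ for all $f\in\mathcal R$) with $\rho(1)=1$ there is a unique $\hat x\in X$ such that $\rho(f)=f(\hat x)$ for all $f\in\mathcal R$. 3. For every positive and multiplicative linear map $\rho\colon\mathcal R\to\mathbb R$ with $\rho(1)=1$ there is a unique $\hat x\in X$ such that $\rho(f)=f(\hat x)$ for all $f\in\mathcal R$. -/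

import Mathlib

open Filter Topology

namespace RieszFunctions

universe u

variable {X : Type u}

/-- A linear subspace of the functions on `X` (here: a unital subalgebra) is a Riesz subspace if it
is closed under the pointwise absolute value. -/
def IsRieszSubspace (R : Subalgebra ℝ (X → ℝ)) : Prop :=
  ∀ f ∈ R, |f| ∈ R

/-- A linear functional is positive if it is nonnegative on pointwise nonnegative functions. -/
def IsPositive {R : Subalgebra ℝ (X → ℝ)} (ω : R →ₗ[ℝ] ℝ) : Prop :=
  ∀ f : R, 0 ≤ (f : X → ℝ) → 0 ≤ ω f

/-- A Daniell integral: a positive linear functional such that `inf_k ω (f_k) = 0` for all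
decreasing sequences of nonnegative functions in `R` with pointwise infimum `0`. -/
def IsDaniellIntegral {R : Subalgebra ℝ (X → ℝ)} (ω : R →ₗ[ℝ] ℝ) : Prop :=
  IsPositive ω ∧
    ∀ f : ℕ → R, (∀ k, 0 ≤ (f k : X → ℝ)) →
      Antitone (fun k => (f k : X → ℝ)) →
      (∀ x : X, IsGLB (Set.range fun k => (f k : X → ℝ) x) 0) →
      IsGLB (Set.range fun k => ω (f k)) 0

/-- A Riesz homomorphism to the reals: a linear map with `ρ |f| = |ρ f|`. -/
def IsRieszHom {R : Subalgebra ℝ (X → ℝ)} (hR : IsRieszSubspace R) (ρ : R →ₗ[ℝ] ℝ) : Prop :=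
  ∀ f : R, ρ ⟨|(f : X → ℝ)|, hR f f.2⟩ = |ρ f|

/-- The functions in `R` whose absolute value is bounded by some member of the sequence `v`. -/
def dominatedSet (R : Subalgebra ℝ (X → ℝ)) (v : ℕ → X → ℝ) : Set (X → ℝ) :=
  {f | f ∈ R ∧ ∃ n, |f| ≤ v n}

/-- A set of functions is a unital subalgebra of the functions on `X`. -/
def IsUnitalSubalgebra (S : Set (X → ℝ)) : Prop :=
  ∃ A : Subalgebra ℝ (X → ℝ), (A : Set (X → ℝ)) = S

/-- `X` is complete with respect to the set `S` of functions: for every net `x` in `X` such that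
`f ∘ x` is a Cauchy net for all `f ∈ S`, there is a point `y` with `f ∘ x → f y` for all
`f ∈ S`. -/
def IsCompleteFor (S : Set (X → ℝ)) : Prop :=
  ∀ (I : Type u) [PartialOrder I] [IsDirectedOrder I] [Nonempty I] (x : I → X),
    (∀ f ∈ S, CauchySeq fun i => f (x i)) →
      ∃ y : X, ∀ f ∈ S, Tendsto (fun i => f (x i)) atTop (𝓝 (f y))

end RieszFunctions

/-!
Write `S` for the dominated functions. Since `S` is a unital algebra, the bound `1` is dominated,
hence `min |f| 1 ∈ S` for every `f ∈ R`. Convergence of all functions of `S` along a filter to their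
values at a point `y` therefore gives information on all of `R`: if `f ∈ R` tends to `0` along the
filter, then `f y = 0`. Completeness, transferred from nets to filters
(`IsCompleteFor.exists_tendsto`), supplies such points `y`.

*Daniell property.* Let `f k` decrease pointwise to `0` and let `ω` be positive. Choose weights
`a n > 0` with `∑ a n * ω (v n * f 0) ≤ 2`. For every `ε > 0` some `k` satisfies
`f k ≤ ε (1 + ∑_{n < k} a n * v n * f 0)`, which after applying `ω` yields `ω (f k) ≤ ε (ω 1 + 2)`.
Otherwise there are points `x k` violating these inequalities. As `f k ≤ f 0`, each `v n` is
bounded along `x`, so all functions of `S` converge along an ultrafilter refining the sequence `x`.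
At the limit point `y` every `f j` is at least `min ε 1`, a contradiction
(`exists_le_of_antitone`).

*Evaluations.* For a unital Riesz homomorphism `ρ`, the sets `{x | |f x - ρ f| < ε}` have the finite
intersection property: `ρ` vanishes on `∑ |f i - ρ (f i)|`, so this sum is not bounded below by a
positive constant. They generate a filter along which every `f` tends to `ρ f`, and the point given
by completeness represents `ρ`. A positive multiplicative functional is a Riesz homomorphism since
`(ρ |f|)² = ρ (f²) = (ρ f)²`.
-/

namespace RieszFunctions

universe u

variable {X : Type u}

/-! ### Completeness and truncation -/

/-- Every proper filter is refined by a net. The net is indexed by the members of the filter under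
reverse inclusion, each being sent to one of its elements. -/
theorem exists_net_tendsto (F : Filter X) [F.NeBot] :
    ∃ (I : Type u) (_ : PartialOrder I) (_ : IsDirectedOrder I) (_ : Nonempty I) (x : I → X),
      Tendsto x atTop F := by
  have hdir : IsDirectedOrder {A : Set X // A ∈ F}ᵒᵈ := ⟨fun A B =>
    ⟨OrderDual.toDual ⟨A.ofDual.1 ∩ B.ofDual.1, Filter.inter_mem A.ofDual.2 B.ofDual.2⟩,
      OrderDual.le_toDual.2 (Subtype.coe_le_coe.1 Set.inter_subset_left),
      OrderDual.le_toDual.2 (Subtype.coe_le_coe.1 Set.inter_subset_right)⟩⟩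
  have hne : Nonempty {A : Set X // A ∈ F}ᵒᵈ := ⟨OrderDual.toDual ⟨Set.univ, Filter.univ_mem⟩⟩
  have hmem : ∀ A : {A : Set X // A ∈ F}ᵒᵈ, ∃ x, x ∈ A.ofDual.1 := fun A =>
    Filter.nonempty_of_mem A.ofDual.2
  choose x hx using hmem
  refine ⟨_, inferInstance, hdir, hne, x, fun A hA => ?_⟩
  refine Filter.mem_atTop_sets.2 ⟨OrderDual.toDual ⟨A, hA⟩, fun B hB => ?_⟩
  exact Subtype.coe_le_coe.2 (OrderDual.toDual_le.1 hB) (hx B)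

theorem IsCompleteFor.exists_tendsto {S : Set (X → ℝ)} (hX : IsCompleteFor S) (F : Filter X)
    [F.NeBot] (h : ∀ f ∈ S, ∃ a, Tendsto f F (𝓝 a)) :
    ∃ y, ∀ f ∈ S, Tendsto f F (𝓝 (f y)) := by
  obtain ⟨I, _, _, _, x, hxF⟩ := exists_net_tendsto F
  obtain ⟨y, hy⟩ := hX I x fun f hf => by
    obtain ⟨a, ha⟩ := h f hf
    exact (ha.comp hxF).cauchy_map
  refine ⟨y, fun f hf => ?_⟩
  obtain ⟨a, ha⟩ := h f hf
  rwa [tendsto_nhds_unique (hy f hf) (ha.comp hxF)]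

theorem IsRieszSubspace.inf_mem {R : Subalgebra ℝ (X → ℝ)} (hR : IsRieszSubspace R)
    {f g : X → ℝ} (hf : f ∈ R) (hg : g ∈ R) : f ⊓ g ∈ R := by
  have h : f ⊓ g = (1 / 2 : ℝ) • (f + g - |f - g|) := by
    ext x
    simp only [Pi.inf_apply, Pi.smul_apply, Pi.sub_apply, Pi.add_apply, Pi.abs_apply, smul_eq_mul]
    rw [inf_eq_half_smul_add_sub_abs_sub ℝ, abs_sub_comm]
    norm_num
  rw [h]
  exact R.smul_mem (R.sub_mem (R.add_mem hf hg) (hR _ (R.sub_mem hf hg))) _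

theorem abs_inf_one_mem_dominatedSet {R : Subalgebra ℝ (X → ℝ)} (hR : IsRieszSubspace R)
    {v : ℕ → X → ℝ} (hS : IsUnitalSubalgebra (dominatedSet R v)) {f : X → ℝ} (hf : f ∈ R) :
    |f| ⊓ 1 ∈ dominatedSet R v := by
  obtain ⟨A, hA⟩ := hS
  obtain ⟨-, n, hn⟩ : (1 : X → ℝ) ∈ dominatedSet R v := hA ▸ A.one_mem
  refine ⟨hR.inf_mem (hR f hf) R.one_mem, n, le_trans ?_ hn⟩
  rw [abs_of_nonneg (le_inf (abs_nonneg f) zero_le_one)]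
  exact inf_le_right.trans (le_abs_self 1)

/-! ### The Daniell property -/

/-- A form of Dini's theorem: a sequence decreasing pointwise to `0` is eventually below `ε`, up to
an error controlled by weighted sums of the dominating functions. -/
theorem exists_le_of_antitone {R : Subalgebra ℝ (X → ℝ)} (hR : IsRieszSubspace R)
    {v : ℕ → X → ℝ} (hv0 : ∀ n, 0 ≤ v n) (hS : IsUnitalSubalgebra (dominatedSet R v))
    (hX : IsCompleteFor (dominatedSet R v)) {f : ℕ → X → ℝ} (hfR : ∀ k, f k ∈ R)
    (hf0 : ∀ k, 0 ≤ f k) (hf : Antitone f) (hinf : ∀ x, IsGLB (Set.range fun k => f k x) 0)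
    {a : ℕ → ℝ} (ha : ∀ n, 0 < a n) {ε : ℝ} (hε : 0 < ε) :
    ∃ k, ∀ x, f k x ≤ ε * (1 + ∑ n ∈ Finset.range k, a n * (v n x * f 0 x)) := by
  by_contra! H
  choose x hx using H
  have hterm : ∀ k n, 0 ≤ a n * (v n (x k) * f 0 (x k)) := fun k n =>
    mul_nonneg (ha n).le (mul_nonneg (hv0 n _) (hf0 0 _))
  have hfε : ∀ k, ε < f k (x k) := fun k => by
    have := Finset.sum_nonneg fun n (_ : n ∈ Finset.range k) => hterm k n
    nlinarith [hx k]
  have hf_le : ∀ k, f k (x k) ≤ f 0 (x k) := fun k => hf (Nat.zero_le k) (x k)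
  have hbound : ∀ n k, n < k → v n (x k) ≤ 1 / (ε * a n) := fun n k hnk => by
    have h1 := Finset.single_le_sum (fun n _ => hterm k n) (Finset.mem_range.2 hnk)
    have h0 : 0 < f 0 (x k) := hε.trans ((hfε k).trans_le (hf_le k))
    rw [le_div_iff₀ (mul_pos hε (ha n))]
    refine le_of_mul_le_mul_right ?_ h0
    have h2 := mul_le_mul_of_nonneg_left h1 hε.le
    have h3 := hx k
    have h4 := hf_le k
    calc v n (x k) * (ε * a n) * f 0 (x k) = ε * (a n * (v n (x k) * f 0 (x k))) := by ring
      _ ≤ 1 * f 0 (x k) := by linarith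
  let U : Ultrafilter ℕ := Ultrafilter.of atTop
  have hU : (U : Filter ℕ) ≤ atTop := Ultrafilter.of_le atTop
  obtain ⟨y, hy⟩ := hX.exists_tendsto (Filter.map x U) fun g hg => by
    obtain ⟨-, n, hn⟩ := hg
    have hmem : Set.Icc (-(1 / (ε * a n))) (1 / (ε * a n)) ∈ Ultrafilter.map (g ∘ x) U := by
      refine hU ((eventually_gt_atTop n).mono fun k hk => ?_)
      exact abs_le.1 ((hn (x k)).trans (hbound n k hk))
    obtain ⟨b, -, hb⟩ := isCompact_Icc.ultrafilter_le_nhds' (Ultrafilter.map (g ∘ x) U) hmem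
    exact ⟨b, hb⟩
  have hlow : ∀ j, min ε 1 ≤ f j y := fun j => by
    have ht := hy _ (abs_inf_one_mem_dominatedSet hR hS (hfR j))
    have h1 : min ε 1 ≤ (|f j| ⊓ 1) y := by
      refine ge_of_tendsto (tendsto_map'_iff.1 ht) (hU ((eventually_ge_atTop j).mono fun k hk => ?_))
      exact min_le_min_right 1 ((hfε k).le.trans ((hf hk (x k)).trans (le_abs_self _)))
    refine h1.trans (inf_le_left.trans ?_)
    exact (abs_of_nonneg (hf0 j y)).le
  exact (lt_min hε one_pos).not_ge ((hinf y).2 (by rintro _ ⟨j, rfl⟩; exact hlow j))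

theorem IsPositive.mono {R : Subalgebra ℝ (X → ℝ)} {ω : R →ₗ[ℝ] ℝ} (hω : IsPositive ω) {f g : R}
    (h : (f : X → ℝ) ≤ g) : ω f ≤ ω g := by
  have := hω (g - f) (by simpa using h)
  rwa [map_sub, sub_nonneg] at this

theorem IsPositive.isDaniellIntegral {R : Subalgebra ℝ (X → ℝ)} (hR : IsRieszSubspace R)
    {v : ℕ → X → ℝ} (hvR : ∀ n, v n ∈ R) (hv0 : ∀ n, 0 ≤ v n)
    (hS : IsUnitalSubalgebra (dominatedSet R v)) (hX : IsCompleteFor (dominatedSet R v))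
    {ω : R →ₗ[ℝ] ℝ} (hω : IsPositive ω) : IsDaniellIntegral ω := by
  refine ⟨hω, fun f hf0 hf hinf => ⟨?_, fun b hb => ?_⟩⟩
  · rintro _ ⟨k, rfl⟩
    exact hω _ (hf0 k)
  let w : ℕ → R := fun n => ⟨v n, hvR n⟩ * f 0
  have hw : ∀ n, 0 ≤ ω (w n) := fun n => hω _ fun x => mul_nonneg (hv0 n x) (hf0 0 x)
  -- The summand `1` keeps the weights positive and finite where `ω (w n) = 0`.
  let a : ℕ → ℝ := fun n => (1 / 2) ^ n / (ω (w n) + 1)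
  have ha : ∀ n, 0 < a n := fun n => div_pos (by positivity) (by linarith [hw n])
  have haw : ∀ n, a n * ω (w n) ≤ (1 / 2) ^ n := fun n => by
    have h1 : 0 < ω (w n) + 1 := by linarith [hw n]
    rw [div_mul_eq_mul_div, div_le_iff₀ h1]
    exact mul_le_mul_of_nonneg_left (by linarith) (by positivity)
  have hω1 : 0 ≤ ω 1 := hω 1 fun _ => zero_le_one
  have key : ∀ ε : ℝ, 0 < ε → b ≤ ε * (ω 1 + 2) := fun ε hε => by
    obtain ⟨k, hk⟩ := exists_le_of_antitone hR hv0 hS hX (fun k => (f k).2) hf0 hf hinf ha hε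
    have h1 : ω (f k) ≤ ω (ε • (1 + ∑ n ∈ Finset.range k, a n • w n)) :=
      hω.mono fun x => by simpa [w, mul_add] using hk x
    have h2 : ∑ n ∈ Finset.range k, a n * ω (w n) ≤ 2 :=
      (Finset.sum_le_sum fun n _ => haw n).trans (sum_geometric_two_le k)
    simp only [map_smul, map_add, map_sum, smul_eq_mul] at h1
    refine (hb ⟨k, rfl⟩).trans (h1.trans ?_)
    gcongr
  refine le_of_forall_pos_le_add fun δ hδ => ?_
  have h := key (δ / (ω 1 + 2)) (by positivity)
  rwa [div_mul_cancel₀ _ (by positivity), ← zero_add δ] at h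

/-! ### Riesz homomorphisms are evaluations -/

theorem IsRieszHom.isPositive {R : Subalgebra ℝ (X → ℝ)} {hR : IsRieszSubspace R}
    {ρ : R →ₗ[ℝ] ℝ} (hρ : IsRieszHom hR ρ) : IsPositive ρ := fun f hf => by
  have h := hρ f
  have he : (⟨|(f : X → ℝ)|, hR f f.2⟩ : R) = f := Subtype.ext (abs_of_nonneg hf)
  rw [he] at h
  exact h ▸ abs_nonneg _

theorem IsPositive.isRieszHom_of_map_mul {R : Subalgebra ℝ (X → ℝ)} (hR : IsRieszSubspace R)
    {ρ : R →ₗ[ℝ] ℝ} (hρ : IsPositive ρ) (hmul : ∀ f g : R, ρ (f * g) = ρ f * ρ g) :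
    IsRieszHom hR ρ := fun f => by
  have h0 : 0 ≤ ρ ⟨|(f : X → ℝ)|, hR f f.2⟩ := hρ _ (abs_nonneg _)
  have hsq : (⟨|(f : X → ℝ)|, hR f f.2⟩ * ⟨|(f : X → ℝ)|, hR f f.2⟩ : R) = f * f :=
    Subtype.ext (funext fun x => abs_mul_abs_self ((f : X → ℝ) x))
  rw [← abs_of_nonneg h0]
  refine (sq_eq_sq_iff_abs_eq_abs _ _).1 ?_
  rw [sq, sq, ← hmul, ← hmul, hsq]

/-- The filter of the points at which finitely many functions `f` are close to `ρ f`. -/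
def valueFilter {R : Subalgebra ℝ (X → ℝ)} (ρ : R →ₗ[ℝ] ℝ) : Filter X :=
  ⨅ f : R, comap (f : X → ℝ) (𝓝 (ρ f))

theorem tendsto_valueFilter {R : Subalgebra ℝ (X → ℝ)} (ρ : R →ₗ[ℝ] ℝ) (f : R) :
    Tendsto (f : X → ℝ) (valueFilter ρ) (𝓝 (ρ f)) :=
  tendsto_comap.mono_left (iInf_le _ f)

theorem IsRieszHom.valueFilter_neBot {R : Subalgebra ℝ (X → ℝ)} {hR : IsRieszSubspace R}
    {ρ : R →ₗ[ℝ] ℝ} (hρ : IsRieszHom hR ρ) (h1 : ρ 1 = 1) : (valueFilter ρ).NeBot := by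
  let d : R → R := fun f => ⟨|((f - ρ f • 1 : R) : X → ℝ)|, hR _ (f - ρ f • 1).2⟩
  have hd : ∀ f, ρ (d f) = 0 := fun f => (hρ (f - ρ f • 1)).trans (by simp [h1])
  have hdx : ∀ f x, (d f : X → ℝ) x = |(f : X → ℝ) x - ρ f| := fun f x => by simp [d]
  have hbasis := HasBasis.iInf' fun f : R => (Metric.nhds_basis_ball (x := ρ f)).comap (f : X → ℝ)
  refine hbasis.neBot_iff.2 fun {i} hi => ?_
  obtain ⟨s, r⟩ := i
  obtain ⟨hs, hr⟩ : s.Finite ∧ ∀ f ∈ s, 0 < r f := hi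
  -- One radius below all `r f`, `f ∈ s`, makes a single sum control the whole intersection.
  obtain ⟨ε, hε, hεr⟩ : ∃ ε : ℝ, 0 < ε ∧ ∀ f ∈ s, ε ≤ r f := by
    rcases s.eq_empty_or_nonempty with rfl | hne
    · exact ⟨1, one_pos, by simp⟩
    · obtain ⟨g, hg, hmin⟩ := Set.exists_min_image s r hs hne
      exact ⟨r g, hr g hg, hmin⟩
  by_contra hempty
  have hle : ((ε • 1 : R) : X → ℝ) ≤ (∑ f ∈ hs.toFinset, d f : R) := fun x => by
    by_contra! hlt
    refine hempty ⟨x, Set.mem_iInter₂.2 fun f hf => ?_⟩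
    have hsum : (d f : X → ℝ) x ≤ ∑ g ∈ hs.toFinset, (d g : X → ℝ) x :=
      Finset.single_le_sum (f := fun g : R => (d g : X → ℝ) x)
        (fun g _ => (abs_nonneg _).trans_eq (hdx g x).symm) (hs.mem_toFinset.2 hf)
    have hlt' : ∑ g ∈ hs.toFinset, (d g : X → ℝ) x < ε := by simpa using hlt
    rw [hdx] at hsum
    exact Metric.mem_ball.2 (hsum.trans_lt (hlt'.trans_le (hεr f hf)))
  have := hρ.isPositive.mono hle
  simp only [map_smul, h1, map_sum, hd, Finset.sum_const_zero, smul_eq_mul, mul_one] at this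
  exact hε.not_ge this

theorem IsRieszHom.existsUnique_eval {R : Subalgebra ℝ (X → ℝ)} {hR : IsRieszSubspace R}
    {v : ℕ → X → ℝ} (hS : IsUnitalSubalgebra (dominatedSet R v))
    (hsep : ∀ x y : X, x ≠ y → ∃ f ∈ dominatedSet R v, f x ≠ f y)
    (hX : IsCompleteFor (dominatedSet R v)) {ρ : R →ₗ[ℝ] ℝ} (hρ : IsRieszHom hR ρ)
    (h1 : ρ 1 = 1) : ∃! x : X, ∀ f : R, ρ f = (f : X → ℝ) x := by
  have := hρ.valueFilter_neBot h1
  obtain ⟨y, hy⟩ := hX.exists_tendsto (valueFilter ρ) fun f hf =>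
    ⟨_, tendsto_valueFilter ρ ⟨f, hf.1⟩⟩
  refine ⟨y, fun f => ?_, fun z hz => ?_⟩
  · -- `f` itself may lie outside `S`; the truncation of `|f - ρ f|` does not.
    have ht := hy _ (abs_inf_one_mem_dominatedSet hR hS (f - ρ f • 1 : R).2)
    have h0 : Tendsto (|((f - ρ f • 1 : R) : X → ℝ)| ⊓ 1) (valueFilter ρ) (𝓝 0) := by
      have h := (tendsto_valueFilter ρ (f - ρ f • 1)).abs.min
        (tendsto_const_nhds (x := (1 : ℝ)))
      simp only [map_sub, map_smul, h1, smul_eq_mul, mul_one, sub_self, abs_zero,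
        min_eq_left zero_le_one] at h
      exact h
    have he : min |(f : X → ℝ) y - ρ f| 1 = 0 := by simpa using tendsto_nhds_unique ht h0
    rcases min_choice |(f : X → ℝ) y - ρ f| 1 with h | h
    · exact (sub_eq_zero.1 (abs_eq_zero.1 (h.symm.trans he))).symm
    · exact absurd (h.symm.trans he) one_ne_zero
  · by_contra hne
    obtain ⟨f, hf, hfne⟩ := hsep z y hne
    refine hfne ((hz ⟨f, hf.1⟩).symm.trans ?_)
    exact tendsto_nhds_unique (tendsto_valueFilter ρ ⟨f, hf.1⟩) (hy f hf)

end RieszFunctions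

theorem theorem5 {X : Type*} (R : Subalgebra ℝ (X → ℝ))
    (hR : RieszFunctions.IsRieszSubspace R)
    (v : ℕ → X → ℝ) (hvR : ∀ n, v n ∈ R) (hv0 : ∀ n, 0 ≤ v n) (hv : Monotone v)
    (hS : RieszFunctions.IsUnitalSubalgebra (RieszFunctions.dominatedSet R v))
    (hsep : ∀ x y : X, x ≠ y → ∃ f ∈ RieszFunctions.dominatedSet R v, f x ≠ f y)
    (hX : RieszFunctions.IsCompleteFor (RieszFunctions.dominatedSet R v)) :
    (∀ ω : R →ₗ[ℝ] ℝ, RieszFunctions.IsPositive ω → RieszFunctions.IsDaniellIntegral ω) ∧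
    (∀ ρ : R →ₗ[ℝ] ℝ, RieszFunctions.IsRieszHom hR ρ → ρ 1 = 1 →
      ∃! x : X, ∀ f : R, ρ f = (f : X → ℝ) x) ∧
    (∀ ρ : R →ₗ[ℝ] ℝ, RieszFunctions.IsPositive ρ → (∀ f g : R, ρ (f * g) = ρ f * ρ g) →
      ρ 1 = 1 → ∃! x : X, ∀ f : R, ρ f = (f : X → ℝ) x) := by
  exact ⟨fun ω hω => hω.isDaniellIntegral hR hvR hv0 hS hX,
    fun ρ hρ h1 => hρ.existsUnique_eval hS hsep hX h1,
    fun ρ hρ hmul h1 => (hρ.isRieszHom_of_map_mul hR hmul).existsUnique_eval hS hsep hX h1⟩
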